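/- For integers $k \ge 1$, $n \ge 1$, the $k\times n$ grid graph has as vertices the integer points $(x,y)$ with $0\le x<n$, $0\le y<k$, two points being adjacent when they are at distance $1$. A Greek key tour on it is a walk (regarded as directed, and identified with its sequence of vertices) that starts in the upper-left corner $(0,k-1)$, never visits a vertex twice, has a trapped endpoint (every neighbour of the endpoint has been visited), and visits every vertex. Let $g_{k,n}$ be the number of Greek key tours on the $k\times n$ grid graph, put $g_{k,0}=1$ (the empty tour), and let $G_k(x)=\sum_{n\ge 0} g_{k,n}x^n$. Then, as formal power series, \[ G_4(x)=\frac{1-2x-2x^2+11x^3+4x^4-10x^5+4x^6+2x^7-3x^8+x^9}{(1-x-3x^2-x^3+x^4)(1-2x-2x^2+2x^3-x^4)}. \] In particular, the sequence $a(n)=g_{4,n}$ (OEIS A046995) satisfies, for all $n\ge 10$, the linear recurrence \[ a(n)=3a(n-1)+3a(n-2)-9a(n-3)-6a(n-4)+5a(n-5)+a(n-6)-3a(n-7)+a(n-8). \] -/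

import Mathlib

namespace GreekKey

open SimpleGraph

/-- The finite grid graph on the points `(x, y)` with `0 ≤ x < n` and `0 ≤ y < k`
(height `k`, width `n`): two points are adjacent when they are at distance one. -/
def gridGraph (k n : ℕ) : SimpleGraph (Fin n × Fin k) :=
  pathGraph n □ pathGraph k

/-- The upper-left corner `(0, k)` of the grid with height `k + 1` and width `n + 1`. -/
def upperLeft (k n : ℕ) : Fin (n + 1) × Fin (k + 1) :=
  (0, Fin.last k)

/-- A growing self-avoiding walk: a (directed) walk that visits no vertex twice and whose
endpoint is trapped, i.e. all neighbours of the endpoint have been visited. -/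
def IsGSAW {V : Type*} {G : SimpleGraph V} {u v : V} (p : G.Walk u v) : Prop :=
  p.IsPath ∧ ∀ w, G.Adj v w → w ∈ p.support

/-- The Greek key tours on the grid with height `k + 1` and width `n + 1`: the growing
self-avoiding walks that start in the upper-left corner and visit every vertex. The endpoint is
arbitrary, so it is the first component of a dependent pair. -/
def greekKeyTours (k n : ℕ) :
    Set (Σ v : Fin (n + 1) × Fin (k + 1), (gridGraph (k + 1) (n + 1)).Walk (upperLeft k n) v) :=
  {p | IsGSAW p.2 ∧ ∀ w, w ∈ p.2.support}

/-- The number of Greek key tours on the `k × n` grid graph. An empty grid has exactly one tour,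
the empty one; this is the convention behind the constant term `1` of the generating function. -/
noncomputable def tourCount : ℕ → ℕ → ℕ
  | k + 1, n + 1 => (greekKeyTours k n).ncard
  | 0, _ => 1
  | _ + 1, 0 => 1

/-- The generating function of Greek key tours of height `k`, as a formal power series. -/
noncomputable def genFun (k : ℕ) : PowerSeries ℚ :=
  PowerSeries.mk fun n => (tourCount k n : ℚ)

end GreekKey

namespace GreekKey

/-! A trapped endpoint is automatic for a tour that visits everything, so the tours are the
Hamiltonian paths from the corner. They are encoded as orderings of the labels 1, …, 4n (columns
from left to right, each from top to bottom), closed up through an extra label 0. The counting is a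
transfer matrix argument that deletes label 1. If a and b are its predecessor and successor, the
link (a, b) becomes prescribed and the other labels drop by one. For fixed (a, b) this is a
bijection, which gives `orderingCount_succ`; the prescribed links are the state. Connectivity needs
no separate bookkeeping: a cycle avoiding 0 would shrink until a = b, which `Compatible` rejects.
Four deletions form a linear operator T on formal combinations of states. If P(T) annihilates the
initial state, the counts satisfy the recurrence with characteristic polynomial P for all n
(`evalWeights_horner`), and no list of states has to be exhibited. The kernel verifies this for one
P of degree 17; computed initial values then reduce it to the recurrence of order eight.
`bijOn_greekKeyTours` carries the result over to walks. -/

/-! ### Links of a sequence -/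

/-- A link `(x, y)` says that `y` is visited immediately after `x`. The label `0` stands for the
outside, from which a tour starts and to which it returns after its last vertex. -/
abbrev Link := ℕ × ℕ

/-- The links of a sequence of labels that follows `c` and finally returns to `0`. -/
def links : ℕ → List ℕ → List Link
  | c, [] => [(c, 0)]
  | c, x :: L => (c, x) :: links x L

/-- The links of a sequence of labels that follows `c`, without the return to `0`. -/
def prefixLinks : ℕ → List ℕ → List Link
  | _, [] => []
  | c, x :: L => (c, x) :: prefixLinks x L

/-- The links of a sequence of labels, with the return to `0`, but without a link into its head. -/
def suffixLinks : List ℕ → List Link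
  | [] => []
  | x :: L => links x L

theorem links_eq_cons (c : ℕ) (L : List ℕ) : links c L = (c, L.headD 0) :: suffixLinks L := by
  cases L <;> rfl

theorem links_append (c : ℕ) (A B : List ℕ) :
    links c (A ++ B) = prefixLinks c A ++ (A.getLastD c, B.headD 0) :: suffixLinks B := by
  induction A generalizing c with
  | nil => exact links_eq_cons c B
  | cons x A ih =>
    rw [List.cons_append, links, ih, prefixLinks, List.cons_append, List.getLastD_cons]

theorem links_insert (c v : ℕ) (A B : List ℕ) :
    links c (A ++ v :: B) =
      prefixLinks c A ++ (A.getLastD c, v) :: (v, B.headD 0) :: suffixLinks B := by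
  rw [links_append, List.headD_cons, suffixLinks, links_eq_cons]

theorem links_map_fst (c : ℕ) (L : List ℕ) : (links c L).map Prod.fst = c :: L := by
  induction L generalizing c with
  | nil => rfl
  | cons x L ih => rw [links, List.map_cons, ih]

theorem links_map_snd (c : ℕ) (L : List ℕ) : (links c L).map Prod.snd = L ++ [0] := by
  induction L generalizing c with
  | nil => rfl
  | cons x L ih => rw [links, List.map_cons, ih]; rfl

theorem links_map {g : ℕ → ℕ} (hg : g 0 = 0) (c : ℕ) (L : List ℕ) :
    links (g c) (L.map g) = (links c L).map (Prod.map g g) := by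
  induction L generalizing c with
  | nil => simp [links, hg]
  | cons x L ih => simp [links, ih]

theorem exists_append_of_mem_links {c : ℕ} {L : List ℕ} {e : Link} (he : e ∈ links c L) :
    ∃ A B, L = A ++ B ∧ A.getLastD c = e.1 ∧ B.headD 0 = e.2 := by
  induction L generalizing c with
  | nil =>
    rw [links, List.mem_singleton] at he
    exact ⟨[], [], rfl, by rw [he]; rfl, by rw [he]; rfl⟩
  | cons x L ih =>
    rw [links, List.mem_cons] at he
    rcases he with rfl | he
    · exact ⟨[], x :: L, rfl, rfl, rfl⟩
    · obtain ⟨A, B, rfl, hA, hB⟩ := ih he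
      exact ⟨x :: A, B, rfl, by rw [List.getLastD_cons, hA], hB⟩

/-- In a list without repetitions, the entry before a cut determines the cut. -/
theorem append_inj_of_getLastD_eq {c : ℕ} {A A' B B' : List ℕ} (hd : (c :: (A ++ B)).Nodup)
    (h : A ++ B = A' ++ B') (hl : A.getLastD c = A'.getLastD c) : A = A' ∧ B = B' := by
  have key : ∀ {c : ℕ} {x : ℕ} {T U : List ℕ}, (c :: (x :: T ++ U)).Nodup →
      (x :: T).getLastD c ≠ c := by
    intro c x T U hd heq
    rw [List.getLastD_cons] at heq
    have hm : T.getLastD x ∈ x :: T := List.getLastD_mem_cons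
    rw [heq] at hm
    exact (List.nodup_cons.1 hd).1 (List.mem_append_left U hm)
  induction A generalizing c A' with
  | nil =>
    cases A' with
    | nil => exact ⟨rfl, h⟩
    | cons x T => rw [h] at hd; exact absurd hl.symm (key hd)
  | cons x A ih =>
    cases A' with
    | nil => exact absurd hl (key hd)
    | cons y T =>
      rw [List.cons_append, List.cons_append, List.cons.injEq] at h
      obtain ⟨rfl, h⟩ := h
      rw [List.getLastD_cons, List.getLastD_cons] at hl
      obtain ⟨rfl, rfl⟩ := ih (List.nodup_cons.1 hd).2 h hl
      exact ⟨rfl, rfl⟩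

/-! ### Bypassing the first vertex -/

/-- The predecessors of the vertex `1` that are possible when the links `f` are prescribed;
`p` says whether the vertices `1` and `2` lie in the same column. -/
def predecessors (p : Bool) (f : List Link) : List ℕ :=
  match f.find? (fun e => e.2 == 1) with
  | some e => [e.1]
  | none => if p then [2, 5] else [5]

/-- The successors of the vertex `1` that are possible when the links `f` are prescribed. -/
def successors (p : Bool) (f : List Link) : List ℕ :=
  match f.find? (fun e => e.1 == 1) with
  | some e => [e.2]
  | none => if p then [0, 2, 5] else [0, 5]

/-- Whether the prescribed links `f` allow the vertex `1` to be visited between `e.1` and `e.2`. -/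
def Compatible (f : List Link) (e : Link) : Bool :=
  e.1 != 1 && e.2 != 1 && (e.1 != e.2 || e.1 == 0 && f.all fun g => g.1 == 1 || g.2 == 1) &&
    f.all fun g => (g.1 != 0 || g.2 != 0) && ((g.1 == e.1) == (g.2 == 1)) &&
      ((g.2 == e.2) == (g.1 == 1))

/-- The links that can result from removing the vertex `1`. -/
def bypasses (p : Bool) (f : List Link) : List Link :=
  (List.product (predecessors p f) (successors p f)).filter (Compatible f)

/-- Insertion into a list of links that is sorted by first components. -/
def insertLink (e : Link) : List Link → List Link
  | [] => [e]
  | g :: f => if e.1 < g.1 then e :: g :: f else g :: insertLink e f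

/-- The prescribed links after the vertex `1` has been bypassed by `e`; the other vertices are
renumbered. -/
def contract (f : List Link) (e : Link) : List Link :=
  insertLink (e.1 - 1, e.2 - 1)
    ((f.filter fun g => g.1 != 1 && g.2 != 1).map fun g => (g.1 - 1, g.2 - 1))

/-- Only membership matters for correctness; the sorting makes equal states coincide as lists, so
that their weights can be collected. -/
theorem mem_insertLink {e g : Link} {f : List Link} : g ∈ insertLink e f ↔ g = e ∨ g ∈ f := by
  induction f with
  | nil => simp [insertLink]
  | cons h f ih =>
    rw [insertLink]
    split
    · simp
    · simp only [List.mem_cons, ih]; tauto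

theorem mem_contract {f : List Link} {e g : Link} :
    g ∈ contract f e ↔ g = (e.1 - 1, e.2 - 1) ∨
      ∃ h ∈ f, h.1 ≠ 1 ∧ h.2 ≠ 1 ∧ (h.1 - 1, h.2 - 1) = g := by
  simp [contract, mem_insertLink, and_assoc]

/-- The links that the grid allows. The vertices of the grid with height four are numbered
columnwise, from top to bottom, and the last of the `m` vertices is at the bottom of a column;
a tour may end anywhere. -/
def GridLink (m x y : ℕ) : Prop :=
  x ≠ 0 ∧ (y = 0 ∨ y ≠ 0 ∧ (y = x + 4 ∨ x = y + 4 ∨ (y = x + 1 ∧ (m - x) % 4 ≠ 0) ∨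
    (x = y + 1 ∧ (m - y) % 4 ≠ 0)))

/-- Column breaks are measured by `m - x`, from the last vertex backwards, so deleting the first
vertex does not move them. -/
theorem gridLink_succ {m x y : ℕ} (hx : x ≠ 1) (hy : y ≠ 1) :
    GridLink (m + 1) x y ↔ GridLink m (x - 1) (y - 1) := by
  unfold GridLink
  have h1 : x ≠ 0 → m + 1 - x = m - (x - 1) := by omega
  have h2 : y ≠ 0 → m + 1 - y = m - (y - 1) := by omega
  rcases Nat.eq_zero_or_pos x with rfl | hx0
  · simp
  rcases Nat.eq_zero_or_pos y with rfl | hy0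
  · simp; omega
  rw [h1 (by omega), h2 (by omega)]
  omega

theorem gridLink_one_right {m x : ℕ} :
    GridLink (m + 1) x 1 ↔ x = 5 ∨ (x = 2 ∧ m % 4 ≠ 0) := by
  unfold GridLink
  rw [Nat.add_sub_cancel]
  omega

theorem gridLink_one_left {m y : ℕ} :
    GridLink (m + 1) 1 y ↔ y = 0 ∨ y = 5 ∨ (y = 2 ∧ m % 4 ≠ 0) := by
  unfold GridLink
  rw [Nat.add_sub_cancel]
  omega

/-- A prescribed link into 1 overrides the grid and need not be a grid edge; only in its absence
does the grid decide. -/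
theorem predecessors_spec {m : ℕ} {f : List Link} :
    (∃ e ∈ f, e.2 = 1 ∧ predecessors (m % 4 != 0) f = [e.1]) ∨
    ((∀ e ∈ f, e.2 ≠ 1) ∧ (predecessors (m % 4 != 0) f).Nodup ∧
      ∀ x, x ∈ predecessors (m % 4 != 0) f ↔ GridLink (m + 1) x 1) := by
  unfold predecessors
  cases h : f.find? (fun e => e.2 == 1) with
  | some e =>
    exact Or.inl ⟨e, List.mem_of_find?_eq_some h, by simpa using List.find?_some h, rfl⟩
  | none =>
    refine Or.inr ⟨by simpa using h, ?_⟩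
    by_cases hm : m % 4 = 0 <;> simp [hm, gridLink_one_right, or_comm]

theorem successors_spec {m : ℕ} {f : List Link} :
    (∃ e ∈ f, e.1 = 1 ∧ successors (m % 4 != 0) f = [e.2]) ∨
    ((∀ e ∈ f, e.1 ≠ 1) ∧ (successors (m % 4 != 0) f).Nodup ∧
      ∀ x, x ∈ successors (m % 4 != 0) f ↔ GridLink (m + 1) 1 x) := by
  unfold successors
  cases h : f.find? (fun e => e.1 == 1) with
  | some e =>
    exact Or.inl ⟨e, List.mem_of_find?_eq_some h, by simpa using List.find?_some h, rfl⟩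
  | none =>
    refine Or.inr ⟨by simpa using h, ?_⟩
    by_cases hm : m % 4 = 0 <;> simp [hm, gridLink_one_left, or_comm]

theorem nodup_bypasses (m : ℕ) (f : List Link) : (bypasses (m % 4 != 0) f).Nodup := by
  refine List.Nodup.filter _ (List.Nodup.product ?_ ?_)
  · rcases predecessors_spec (m := m) (f := f) with ⟨e, -, -, h⟩ | ⟨-, h, -⟩
    · rw [h]; exact List.nodup_singleton _
    · exact h
  · rcases successors_spec (m := m) (f := f) with ⟨e, -, -, h⟩ | ⟨-, h, -⟩
    · rw [h]; exact List.nodup_singleton _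
    · exact h

/-- A prescribed link leaving a must be the one into 1, and one entering b must be the one out of 1.
The case a = b closes a cycle, allowed only at 0 when 1 is the whole remaining tour, so that every
prescribed link touches 1. A prescribed (0, 0) would have closed the tour too early. -/
theorem compatible_iff {f : List Link} {a b : ℕ} :
    Compatible f (a, b) = true ↔ a ≠ 1 ∧ b ≠ 1 ∧
      (a = b → a = 0 ∧ ∀ g ∈ f, g.1 = 1 ∨ g.2 = 1) ∧
      ∀ g ∈ f, ¬ (g.1 = 0 ∧ g.2 = 0) ∧ (g.1 = a ↔ g.2 = 1) ∧ (g.2 = b ↔ g.1 = 1) := by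
  simp only [Compatible, Bool.and_eq_true, Bool.or_eq_true, bne_iff_ne,
    List.all_eq_true, ne_eq, Bool.beq_eq_decide_eq, decide_eq_decide]
  grind

/-- The links in `K` include the prescribed ones, and the others are allowed by the grid. -/
def Admissible (m : ℕ) (f K : List Link) : Prop :=
  (∀ e ∈ f, e ∈ K) ∧ ∀ e ∈ K, e ∈ f ∨ GridLink m e.1 e.2

/-- The links in O avoid 1 and correspond under the shift. The new link is admissible because
`contract` prescribes it, so the conditions on the two deleted links all move into `bypasses`. -/
theorem admissible_succ_iff {m a b : ℕ} {f O K K' : List Link}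
    (hK : ∀ e, e ∈ K ↔ e = (a, 1) ∨ e = (1, b) ∨ e ∈ O)
    (hK' : ∀ e, e ∈ K' ↔ e = (a - 1, b - 1) ∨ ∃ g ∈ O, (g.1 - 1, g.2 - 1) = e)
    (ha : a ≠ 1) (hb : b ≠ 1) (hO : ∀ e ∈ O, e.1 ≠ a ∧ e.1 ≠ 1 ∧ e.2 ≠ b ∧ e.2 ≠ 1)
    (h0 : (0, 0) ∉ O) (hab : a = b → a = 0 ∧ O = []) :
    Admissible (m + 1) f K ↔
      (a, b) ∈ bypasses (m % 4 != 0) f ∧ Admissible m (contract f (a, b)) K' := by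
  -- Truncated subtraction fixes 0 and is injective away from 1, so it renumbers the vertices and
  -- keeps the outside label.
  have inj : ∀ {x y : ℕ}, x ≠ 1 → y ≠ 1 → x - 1 = y - 1 → x = y := by omega
  have hp := predecessors_spec (m := m) (f := f)
  have hs := successors_spec (m := m) (f := f)
  have hprod : (a, b) ∈ List.product (predecessors (m % 4 != 0) f) (successors (m % 4 != 0) f) ↔
      a ∈ predecessors (m % 4 != 0) f ∧ b ∈ successors (m % 4 != 0) f := List.pair_mem_product
  rw [bypasses, List.mem_filter, compatible_iff, hprod]
  constructor
  · rintro ⟨hf, hG⟩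
    have hfK : ∀ g ∈ f, g = (a, 1) ∨ g = (1, b) ∨ g ∈ O := fun g hg => (hK g).1 (hf g hg)
    refine ⟨⟨⟨?_, ?_⟩, ha, hb, fun h => ⟨(hab h).1, fun g hg => ?_⟩, fun g hg => ?_⟩,
      fun e he => ?_, fun e he => ?_⟩
    · rcases hp with ⟨e, he, he1, hp⟩ | ⟨hn, -, hp⟩
      · rw [hp, List.mem_singleton]
        rcases hfK e he with rfl | rfl | h
        · rfl
        · exact absurd he1 hb
        · exact absurd he1 (hO e h).2.2.2
      · exact (hp a).2 ((hG (a, 1) ((hK _).2 (Or.inl rfl))).resolve_left fun h => hn _ h rfl)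
    · rcases hs with ⟨e, he, he1, hs⟩ | ⟨hn, -, hs⟩
      · rw [hs, List.mem_singleton]
        rcases hfK e he with rfl | rfl | h
        · exact absurd he1 ha
        · rfl
        · exact absurd he1 (hO e h).2.1
      · exact (hs b).2 ((hG (1, b) ((hK _).2 (Or.inr (Or.inl rfl)))).resolve_left
          fun h => hn _ h rfl)
    · rcases hfK g hg with rfl | rfl | h'
      · exact Or.inr rfl
      · exact Or.inl rfl
      · rw [(hab h).2] at h'; simp at h'
    · rcases hfK g hg with rfl | rfl | h
      · exact ⟨by simp, by simp, by simp [hb.symm, ha]⟩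
      · exact ⟨by simp, by simp [ha.symm, hb], by simp⟩
      · obtain ⟨h1, h2, h3, h4⟩ := hO g h
        refine ⟨fun h' => h0 ?_, by simp [h1, h4], by simp [h2, h3]⟩
        rwa [← Prod.mk.eta (p := g), h'.1, h'.2] at h
    · rcases mem_contract.1 he with rfl | ⟨g, hg, hg1, hg2, rfl⟩
      · exact (hK' _).2 (Or.inl rfl)
      · rcases hfK g hg with rfl | rfl | h
        · exact absurd rfl hg2
        · exact absurd rfl hg1
        · exact (hK' _).2 (Or.inr ⟨g, h, rfl⟩)
    · rcases (hK' e).1 he with rfl | ⟨g, hg, rfl⟩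
      · exact Or.inl (mem_contract.2 (Or.inl rfl))
      · obtain ⟨h1, h2, h3, h4⟩ := hO g hg
        rcases hG g ((hK g).2 (Or.inr (Or.inr hg))) with h | h
        · exact Or.inl (mem_contract.2 (Or.inr ⟨g, h, h2, h4, rfl⟩))
        · exact Or.inr ((gridLink_succ h2 h4).1 h)
  · rintro ⟨⟨⟨h1, h2⟩, -, -, h3, h4⟩, hf, hG⟩
    refine ⟨fun e he => ?_, fun e he => ?_⟩
    · obtain ⟨-, h5, h6⟩ := h4 e he
      rw [hK]
      by_cases e2 : e.2 = 1
      · exact Or.inl (Prod.ext (h5.2 e2) e2)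
      by_cases e1 : e.1 = 1
      · exact Or.inr (Or.inl (Prod.ext e1 (h6.2 e1)))
      refine Or.inr (Or.inr ?_)
      have hc := hf _ (mem_contract.2 (Or.inr ⟨e, he, e1, e2, rfl⟩))
      rcases (hK' _).1 hc with h | ⟨g, hg, h⟩
      · exact absurd (h5.1 (inj e1 ha (Prod.mk.inj h).1)) e2
      · obtain ⟨-, g1, -, g2⟩ := hO g hg
        have : g = e := Prod.ext (inj g1 e1 (Prod.mk.inj h).1) (inj g2 e2 (Prod.mk.inj h).2)
        rwa [← this]
    · rcases (hK e).1 he with rfl | rfl | h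
      · rcases hp with ⟨e, he, he1, hp⟩ | ⟨hn, -, hp⟩
        · rw [hp, List.mem_singleton] at h1
          exact Or.inl (by rw [h1, ← he1]; exact he)
        · exact Or.inr ((hp a).1 h1)
      · rcases hs with ⟨e, he, he1, hs⟩ | ⟨hn, -, hs⟩
        · rw [hs, List.mem_singleton] at h2
          exact Or.inl (by rw [h2, ← he1]; exact he)
        · exact Or.inr ((hs b).1 h2)
      · obtain ⟨e1, e2, e3, e4⟩ := hO e h
        rcases hG _ ((hK' _).2 (Or.inr ⟨e, h, rfl⟩)) with h' | h'
        · rcases mem_contract.1 h' with h' | ⟨g, hg, g1, g2, h'⟩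
          · exact absurd (inj e2 ha (Prod.mk.inj h').1) e1
          · have : g = e := Prod.ext (inj g1 e2 (Prod.mk.inj h').1) (inj g2 e4 (Prod.mk.inj h').2)
            exact Or.inl (this ▸ hg)
        · exact Or.inr ((gridLink_succ e2 e4).2 h')

/-! ### Orderings and the removal of label 1 -/

/-- The sequences of the labels `1, …, m` in some order, with admissible links. -/
def orderings (m : ℕ) (f : List Link) : Set (List ℕ) :=
  {L | L.Nodup ∧ (∀ x, x ∈ L ↔ 1 ≤ x ∧ x ≤ m) ∧ Admissible m f (links 0 L)}

/-- The number of admissible orderings of the labels `1, …, m`. -/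
noncomputable def orderingCount (m : ℕ) (f : List Link) : ℕ :=
  (orderings m f).ncard

theorem finite_orderings (m : ℕ) (f : List Link) : (orderings m f).Finite := by
  refine (List.finite_toSet (List.range' 1 m).permutations).subset fun L hL => ?_
  refine List.mem_permutations.2 ((List.perm_ext_iff_of_nodup hL.1 List.nodup_range').2 fun x => ?_)
  rw [hL.2.1, List.mem_range'_1]
  omega

/-- The removal of the label `1`; the other labels are renumbered. -/
def removeOne (L : List ℕ) : List ℕ :=
  (L.erase 1).map fun x => x - 1

theorem removeOne_append {A B : List ℕ} (h : 1 ∉ A) :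
    removeOne (A ++ 1 :: B) = (A ++ B).map fun x => x - 1 := by
  rw [removeOne, List.erase_append_right _ h, List.erase_cons_head]

theorem links_fst_injOn {c : ℕ} {L : List ℕ} (h : (c :: L).Nodup) {e g : Link}
    (he : e ∈ links c L) (hg : g ∈ links c L) (heg : e.1 = g.1) : e = g := by
  rw [← links_map_fst] at h
  exact List.inj_on_of_nodup_map h he hg heg

theorem links_snd_injOn {c : ℕ} {L : List ℕ} (h : (0 :: L).Nodup) {e g : Link}
    (he : e ∈ links c L) (hg : g ∈ links c L) (heg : e.2 = g.2) : e = g := by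
  have h' : (L ++ [0]).Nodup := (List.perm_append_singleton 0 L).nodup_iff.2 h
  rw [← links_map_snd c] at h'
  exact List.inj_on_of_nodup_map h' he hg heg

theorem zero_zero_notMem_links {L : List ℕ} (h : (0 :: L).Nodup) (hL : L ≠ []) :
    (0, 0) ∉ links 0 L := by
  intro h0
  cases L with
  | nil => exact hL rfl
  | cons x L =>
    have h1 : (0, x) ∈ links 0 (x :: L) := List.mem_cons_self
    rw [← (Prod.mk.inj (links_fst_injOn h h0 h1 rfl)).2] at h
    exact (List.nodup_cons.1 h).1 List.mem_cons_self

theorem headD_mem_or_eq {B : List ℕ} {d : ℕ} : B.headD d ∈ B ∨ B = [] ∧ B.headD d = d := by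
  cases B <;> simp

theorem getLastD_mem_or_eq {A : List ℕ} {c : ℕ} : A.getLastD c ∈ A ∨ A = [] ∧ A.getLastD c = c := by
  cases A with
  | nil => simp
  | cons x A => exact Or.inl (by rw [List.getLastD_cons]; exact List.getLastD_mem_cons)

/-- The effect of the removal of the label `1` on the links. -/
theorem admissible_links_insert {m : ℕ} {f : List Link} {A B : List ℕ}
    (hd : (0 :: (A ++ 1 :: B)).Nodup) :
    Admissible (m + 1) f (links 0 (A ++ 1 :: B)) ↔
      (A.getLastD 0, B.headD 0) ∈ bypasses (m % 4 != 0) f ∧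
        Admissible m (contract f (A.getLastD 0, B.headD 0))
          (links 0 ((A ++ B).map fun x => x - 1)) := by
  have h1 : links 0 (A ++ 1 :: B) = prefixLinks 0 A ++
      (A.getLastD 0, 1) :: (1, B.headD 0) :: suffixLinks B := links_insert 0 1 A B
  have hd' := hd
  simp only [List.nodup_cons, List.nodup_append, List.mem_append, List.mem_cons, not_or] at hd'
  obtain ⟨⟨h0A, -, h0B⟩, -, ⟨h1B, -⟩, hdis⟩ := hd'
  have h1A : 1 ∉ A := fun h => hdis 1 h 1 (Or.inl rfl) rfl
  have hmem : ∀ e, e ∈ links 0 (A ++ 1 :: B) ↔ e = (A.getLastD 0, 1) ∨ e = (1, B.headD 0) ∨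
      e ∈ prefixLinks 0 A ++ suffixLinks B := by
    intro e
    rw [h1]
    simp only [List.mem_append, List.mem_cons]
    tauto
  have ha : A.getLastD 0 ≠ 1 := by
    rcases getLastD_mem_or_eq (A := A) (c := 0) with h | ⟨-, h⟩
    · exact fun h' => h1A (h' ▸ h)
    · rw [h]; exact zero_ne_one
  have hb : B.headD 0 ≠ 1 := by
    rcases headD_mem_or_eq (B := B) (d := 0) with h | ⟨-, h⟩
    · exact fun h' => h1B (h' ▸ h)
    · rw [h]; exact zero_ne_one
  have hn : ((prefixLinks 0 A ++ (A.getLastD 0, 1) :: (1, B.headD 0) :: suffixLinks B).map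
      Prod.fst).Nodup := by rw [← h1, links_map_fst]; exact hd
  have hn' : ((prefixLinks 0 A ++ (A.getLastD 0, 1) :: (1, B.headD 0) :: suffixLinks B).map
      Prod.snd).Nodup := by
    rw [← h1, links_map_snd]; exact (List.perm_append_singleton 0 _).nodup_iff.2 hd
  have hO : ∀ e ∈ prefixLinks 0 A ++ suffixLinks B,
      e.1 ≠ A.getLastD 0 ∧ e.1 ≠ 1 ∧ e.2 ≠ B.headD 0 ∧ e.2 ≠ 1 := by
    intro e he
    simp only [List.map_append, List.map_cons, List.nodup_middle, List.nodup_cons,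
      List.mem_append, List.mem_cons, List.mem_map] at hn hn' he
    grind
  refine admissible_succ_iff hmem ?_ ha hb hO ?_ ?_
  · intro e
    rw [links_map (g := fun x => x - 1) rfl 0, links_append]
    simp only [List.mem_map, List.mem_append, List.mem_cons, Prod.map]
    constructor
    · rintro ⟨g, hg | rfl | hg, rfl⟩
      · exact Or.inr ⟨g, Or.inl hg, rfl⟩
      · exact Or.inl rfl
      · exact Or.inr ⟨g, Or.inr hg, rfl⟩
    · rintro (rfl | ⟨g, hg | hg, rfl⟩)
      · exact ⟨_, Or.inr (Or.inl rfl), rfl⟩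
      · exact ⟨g, Or.inl hg, rfl⟩
      · exact ⟨g, Or.inr (Or.inr hg), rfl⟩
  · exact fun h => zero_zero_notMem_links hd (by simp) ((hmem _).2 (Or.inr (Or.inr h)))
  · intro hab
    rcases getLastD_mem_or_eq (A := A) (c := 0) with h | ⟨rfl, h⟩
    · rcases headD_mem_or_eq (B := B) (d := 0) with h' | ⟨-, h'⟩
      · exact absurd hab (hdis _ h _ (Or.inr h'))
      · rw [hab, h'] at h; exact absurd h h0A
    · rcases headD_mem_or_eq (B := B) (d := 0) with h' | ⟨rfl, -⟩
      · rw [← hab, h] at h'; exact absurd h' h0B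
      · exact ⟨h, rfl⟩

theorem exists_of_mem_orderings {m : ℕ} {f : List Link} {L : List ℕ}
    (hL : L ∈ orderings (m + 1) f) : ∃ A B, L = A ++ 1 :: B ∧ 1 ∉ A ∧
      (∀ x ∈ A ++ B, 2 ≤ x ∧ x ≤ m + 1) ∧ (0 :: (A ++ 1 :: B)).Nodup := by
  obtain ⟨hd, hm, -⟩ := hL
  obtain ⟨A, B, rfl⟩ := List.append_of_mem ((hm 1).2 ⟨le_rfl, by omega⟩)
  have hd' := hd
  rw [List.nodup_middle, List.nodup_cons] at hd'
  refine ⟨A, B, rfl, fun h => hd'.1 (List.mem_append_left _ h), fun x hx => ?_,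
    List.nodup_cons.2 ⟨fun h => by have := (hm 0).1 h; omega, hd⟩⟩
  have h1 : x ≠ 1 := fun h => hd'.1 (h ▸ hx)
  have h2 := (hm x).1 (by simp only [List.mem_append, List.mem_cons] at hx ⊢; tauto)
  omega

theorem pred_injOn {A : List ℕ} (h : ∀ x ∈ A, 2 ≤ x) :
    ∀ x ∈ A, ∀ y ∈ A, x - 1 = y - 1 → x = y := by
  intro x hx y hy hxy
  have := h x hx
  have := h y hy
  omega


theorem mem_links_insert {A B : List ℕ} (hd : (0 :: (A ++ 1 :: B)).Nodup) {a b : ℕ}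
    (ha : (a, 1) ∈ links 0 (A ++ 1 :: B)) (hb : (1, b) ∈ links 0 (A ++ 1 :: B)) :
    A.getLastD 0 = a ∧ B.headD 0 = b := by
  have h1 := links_insert 0 1 A B
  have hA : (A.getLastD 0, 1) ∈ links 0 (A ++ 1 :: B) := by rw [h1]; simp
  have hB : (1, B.headD 0) ∈ links 0 (A ++ 1 :: B) := by rw [h1]; simp
  exact ⟨(Prod.mk.inj (links_snd_injOn hd hA ha rfl)).1,
    (Prod.mk.inj (links_fst_injOn hd hB hb rfl)).2⟩

/-- The orderings in which the label `1` is visited between `e.1` and `e.2`. -/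
def orderingsVia (m : ℕ) (f : List Link) (e : Link) : Set (List ℕ) :=
  {L ∈ orderings m f | (e.1, 1) ∈ links 0 L ∧ (1, e.2) ∈ links 0 L}

theorem exists_of_mem_orderingsVia {m : ℕ} {f : List Link} {e : Link} {L : List ℕ}
    (hL : L ∈ orderingsVia (m + 1) f e) : ∃ A B, L = A ++ 1 :: B ∧ 1 ∉ A ∧
      (∀ x ∈ A ++ B, 2 ≤ x ∧ x ≤ m + 1) ∧ (0 :: (A ++ 1 :: B)).Nodup ∧
      (A.getLastD 0, B.headD 0) = e := by
  obtain ⟨hL, ha, hb⟩ := hL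
  obtain ⟨A, B, rfl, h1, h2, hd⟩ := exists_of_mem_orderings hL
  obtain ⟨ha, hb⟩ := mem_links_insert hd ha hb
  exact ⟨A, B, rfl, h1, h2, hd, Prod.ext ha hb⟩

theorem mapsTo_removeOne (m : ℕ) (f : List Link) (e : Link) :
    Set.MapsTo removeOne (orderingsVia (m + 1) f e) (orderings m (contract f e)) := by
  intro L hL
  have hL' := hL.1
  obtain ⟨A, B, rfl, h1, h2, hd, rfl⟩ := exists_of_mem_orderingsVia hL
  have hd' := (List.nodup_cons.1 (List.nodup_middle.1 (List.nodup_cons.1 hd).2)).2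
  rw [removeOne_append h1]
  refine ⟨hd'.map_on (pred_injOn fun x hx => (h2 x hx).1), fun x => ?_,
    ((admissible_links_insert hd).1 hL'.2.2).2⟩
  rw [List.mem_map]
  constructor
  · rintro ⟨y, hy, rfl⟩
    have := h2 y hy
    omega
  · intro hx
    have hm := (hL'.2.1 (x + 1)).2 (by omega)
    refine ⟨x + 1, ?_, rfl⟩
    simp only [List.mem_append, List.mem_cons] at hm ⊢
    rcases hm with h | h | h
    · exact Or.inl h
    · omega
    · exact Or.inr h

/-- The predecessor e.1 marks the place where 1 has to be reinserted. -/
theorem injOn_removeOne (m : ℕ) (f : List Link) (e : Link) :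
    Set.InjOn removeOne (orderingsVia (m + 1) f e) := by
  intro L hL L' hL' h
  obtain ⟨A, B, rfl, h1, h2, hd, he⟩ := exists_of_mem_orderingsVia hL
  obtain ⟨A', B', rfl, h1', h2', hd', he'⟩ := exists_of_mem_orderingsVia hL'
  rw [removeOne_append h1, removeOne_append h1'] at h
  have hp : ∀ M : List ℕ, (∀ x ∈ M, 2 ≤ x ∧ x ≤ m + 1) →
      (M.map fun x => x - 1).map (fun x => x + 1) = M := by
    intro M hM
    rw [List.map_map]
    refine (List.map_congr_left fun x hx => ?_).trans (List.map_id M)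
    have := hM x hx
    simp only [Function.comp, id]
    omega
  have h3 : A ++ B = A' ++ B' := by rw [← hp _ h2, h, hp _ h2']
  have hs : (0 :: (A ++ B)).Nodup :=
    hd.sublist ((List.Sublist.append_left (List.sublist_cons_self 1 B) A).cons_cons 0)
  obtain ⟨rfl, rfl⟩ := append_inj_of_getLastD_eq hs h3 (Prod.mk.inj (he.trans he'.symm)).1
  rfl

/-- The contracted link is prescribed, hence occurs in the shorter ordering; cutting there and
inserting 1 gives a preimage. -/
theorem surjOn_removeOne {m : ℕ} {f : List Link} {e : Link}
    (he : e ∈ bypasses (m % 4 != 0) f) :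
    Set.SurjOn removeOne (orderingsVia (m + 1) f e) (orderings m (contract f e)) := by
  rintro L ⟨hd, hm, hL⟩
  have hc := (compatible_iff (f := f)).1 (List.mem_filter.1 he).2
  obtain ⟨A, B, rfl, ha, hb⟩ :=
    exists_append_of_mem_links (hL.1 _ (mem_contract.2 (Or.inl rfl)))
  -- Compatibility excludes e.1 = 1, so an empty A forces e.1 = 0, the default value.
  have hA : (A.map fun x => x + 1).getLastD 0 = e.1 := by
    cases A with
    | nil =>
      change 0 = e.1 - 1 at ha
      change 0 = e.1
      omega
    | cons x T =>
      have := (hm (T.getLastD x)).1 (List.mem_append_left B List.getLastD_mem_cons)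
      rw [List.getLastD_cons] at ha
      rw [List.map_cons, List.getLastD_cons, List.getLastD_map (f := fun x => x + 1)]
      change T.getLastD x = e.1 - 1 at ha
      omega
  have hB : (B.map fun x => x + 1).headD 0 = e.2 := by
    cases B with
    | nil =>
      change 0 = e.2 - 1 at hb
      change 0 = e.2
      omega
    | cons x T =>
      have := (hm x).1 (List.mem_append_right A List.mem_cons_self)
      change x = e.2 - 1 at hb
      change x + 1 = e.2
      omega
  set A' := A.map fun x => x + 1 with hA'
  set B' := B.map fun x => x + 1 with hB'
  have hAB : (A' ++ B').map (fun x => x - 1) = A ++ B := by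
    simp [hA', hB', Function.comp_def]
  have h2 : ∀ x, x ∈ A' ++ B' ↔ 2 ≤ x ∧ x ≤ m + 1 := by
    intro x
    rw [hA', hB', ← List.map_append, List.mem_map]
    constructor
    · rintro ⟨y, hy, rfl⟩
      have := (hm y).1 hy
      omega
    · intro hx
      exact ⟨x - 1, (hm _).2 (by omega), by omega⟩
  have h1 : 1 ∉ A' := fun h => by have := (h2 1).1 (List.mem_append_left _ h); omega
  have hd1 : (A' ++ 1 :: B').Nodup := by
    rw [List.nodup_middle, List.nodup_cons, h2]
    refine ⟨by omega, ?_⟩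
    rw [hA', hB', ← List.map_append]
    exact hd.map (add_left_injective 1)
  have hm1 : ∀ x, x ∈ A' ++ 1 :: B' ↔ 1 ≤ x ∧ x ≤ m + 1 := by
    intro x
    rw [(List.perm_middle (a := 1) (l₁ := A') (l₂ := B')).mem_iff, List.mem_cons, h2]
    omega
  have hd0 : (0 :: (A' ++ 1 :: B')).Nodup :=
    List.nodup_cons.2 ⟨fun h => by have := (hm1 0).1 h; omega, hd1⟩
  have he' : (A'.getLastD 0, B'.headD 0) = e := Prod.ext hA hB
  have hlinks := links_insert 0 1 A' B'
  refine ⟨A' ++ 1 :: B', ⟨⟨hd1, hm1, (admissible_links_insert hd0).2 ?_⟩, ?_, ?_⟩, ?_⟩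
  · rw [he', hAB]
    exact ⟨he, hL⟩
  · rw [hlinks, ← hA]; simp
  · rw [hlinks, ← hB]; simp
  · rw [removeOne_append h1, hAB]

theorem orderings_succ_eq_biUnion (m : ℕ) (f : List Link) :
    orderings (m + 1) f =
      ⋃ e ∈ ((bypasses (m % 4 != 0) f).toFinset : Set Link), orderingsVia (m + 1) f e := by
  ext L
  simp only [Set.mem_iUnion, List.coe_toFinset, Set.mem_ofPred_eq, exists_prop]
  constructor
  · intro hL
    obtain ⟨A, B, rfl, h1, h2, hd⟩ := exists_of_mem_orderings hL
    refine ⟨_, ((admissible_links_insert hd).1 hL.2.2).1, hL, ?_, ?_⟩ <;>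
    · rw [links_insert]; simp
  · rintro ⟨e, -, hL⟩
    exact hL.1

theorem disjoint_orderingsVia {m : ℕ} {f : List Link} {e g : Link} (h : e ≠ g) :
    Disjoint (orderingsVia (m + 1) f e) (orderingsVia (m + 1) f g) := by
  rw [Set.disjoint_left]
  intro L he hg
  obtain ⟨A, B, rfl, -, -, hd, rfl⟩ := exists_of_mem_orderingsVia he
  obtain ⟨h1, h2⟩ := mem_links_insert hd hg.2.1 hg.2.2
  exact h (Prod.ext h1 h2)

/-- The recursion that removes the first label. -/
theorem orderingCount_succ (m : ℕ) (f : List Link) :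
    orderingCount (m + 1) f =
      ((bypasses (m % 4 != 0) f).map fun e => orderingCount m (contract f e)).sum := by
  rw [orderingCount, orderings_succ_eq_biUnion, (Finset.finite_toSet _).ncard_biUnion
    (fun e _ => (finite_orderings (m + 1) f).subset fun L hL => hL.1)
    (fun e _ g _ h => disjoint_orderingsVia h), finsum_mem_coe_finset,
    List.sum_toFinset _ (nodup_bypasses m f)]
  refine congrArg List.sum (List.map_congr_left fun e he => ?_)
  exact Set.BijOn.ncard_eq (f := removeOne)
    ⟨mapsTo_removeOne m f e, injOn_removeOne m f e, surjOn_removeOne he⟩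

/-- The empty ordering has the single link (0, 0), which the grid never allows, so it must be
prescribed. -/
theorem orderingCount_zero (f : List Link) :
    orderingCount 0 f = if (0, 0) ∈ f ∧ ∀ e ∈ f, e = (0, 0) then 1 else 0 := by
  have h : orderings 0 f = {L | L = [] ∧ (0, 0) ∈ f ∧ ∀ e ∈ f, e = (0, 0)} := by
    ext L
    simp only [orderings, Set.mem_ofPred_eq]
    constructor
    · rintro ⟨-, hm, hf, hG⟩
      obtain rfl : L = [] := List.eq_nil_iff_forall_not_mem.2 fun x hx => by
        have := (hm x).1 hx; omega
      refine ⟨rfl, ?_, fun e he => List.mem_singleton.1 (hf e he)⟩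
      exact (hG (0, 0) (List.mem_singleton.2 rfl)).resolve_right fun h => h.1 rfl
    · rintro ⟨rfl, h0, hf⟩
      refine ⟨List.nodup_nil, fun x => by simp; omega, fun e he => List.mem_singleton.2 (hf e he),
        fun e he => Or.inl ?_⟩
      rw [links, List.mem_singleton] at he
      rw [he]; exact h0
  rw [orderingCount, h]
  split_ifs with hf
  · rw [Set.ncard_eq_one]
    exact ⟨[], Set.ext fun L => ⟨fun hL => hL.1, fun hL => ⟨hL, hf⟩⟩⟩
  · rw [Set.ncard_eq_zero (h ▸ finite_orderings 0 f), Set.eq_empty_iff_forall_notMem]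
    exact fun L hL => hf hL.2

/-! ### The transfer operator on formal combinations of states -/

/-- Formal integral combinations of lists of prescribed links. -/
abbrev Weights := List (List Link × ℤ)

/-- Equality of lists of links, by a fast comparison. -/
def sameLinks : List Link → List Link → Bool
  | [], [] => true
  | e :: f, e' :: f' => (Nat.beq e.1 e'.1).and ((Nat.beq e.2 e'.2).and (sameLinks f f'))
  | _, _ => false

theorem eq_of_sameLinks : ∀ {f g : List Link}, sameLinks f g = true → f = g
  | [], [], _ => rfl
  | [], _ :: _, h => by simp [sameLinks] at h
  | _ :: _, [], h => by simp [sameLinks] at h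
  | e :: f, e' :: f', h => by
    simp only [sameLinks, Bool.and_eq_true, Nat.beq_eq] at h
    rw [Prod.ext h.1 h.2.1, eq_of_sameLinks h.2.2]

/-- Adds `c` times `f`, collecting equal terms. -/
def addWeight (f : List Link) (c : ℤ) : Weights → Weights
  | [] => [(f, c)]
  | (g, d) :: w => if sameLinks f g then (g, d + c) :: w else (g, d) :: addWeight f c w

/-- Adds `c` times each of the lists in `fs`. -/
def addWeights (c : ℤ) : List (List Link) → Weights → Weights
  | [], w => w
  | f :: fs, w => addWeights c fs (addWeight f c w)

/-- The effect of the removal of the first vertex. -/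
def stepWeights (p : Bool) : Weights → Weights
  | [] => []
  | (f, c) :: w => addWeights c ((bypasses p f).map (contract f)) (stepWeights p w)

/-- The effect of the removal of the first column. -/
def columnWeights (w : Weights) : Weights :=
  stepWeights false (stepWeights true (stepWeights true (stepWeights true w)))

/-- The polynomial with the given coefficients, evaluated at the operator `columnWeights`
and applied to the single prescribed link into the upper left corner. -/
def horner : List ℤ → Weights
  | [] => []
  | c :: cs => addWeight [(0, 1)] c (columnWeights (horner cs))

/-- The linear extension of `orderingCount m`. -/
noncomputable def evalWeights (m : ℕ) : Weights → ℤ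
  | [] => 0
  | (f, c) :: w => c * orderingCount m f + evalWeights m w

theorem evalWeights_addWeight (m : ℕ) (f : List Link) (c : ℤ) (w : Weights) :
    evalWeights m (addWeight f c w) = c * orderingCount m f + evalWeights m w := by
  induction w with
  | nil => rfl
  | cons gd w ih =>
    obtain ⟨g, d⟩ := gd
    rw [addWeight]
    split_ifs with h
    · rw [eq_of_sameLinks h, evalWeights, evalWeights]
      ring
    · rw [evalWeights, evalWeights, ih]
      ring

theorem evalWeights_addWeights (m : ℕ) (c : ℤ) (fs : List (List Link)) (w : Weights) :
    evalWeights m (addWeights c fs w) =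
      c * ((fs.map (orderingCount m)).sum : ℕ) + evalWeights m w := by
  induction fs generalizing w with
  | nil => simp [addWeights]
  | cons f fs ih =>
    rw [addWeights, ih, evalWeights_addWeight, List.map_cons, List.sum_cons]
    push_cast
    ring

theorem evalWeights_stepWeights (m : ℕ) (w : Weights) :
    evalWeights m (stepWeights (m % 4 != 0) w) = evalWeights (m + 1) w := by
  induction w with
  | nil => rfl
  | cons fc w ih =>
    rw [stepWeights, evalWeights_addWeights, ih, evalWeights, orderingCount_succ, List.map_map]
    rfl

theorem evalWeights_columnWeights (n : ℕ) (w : Weights) :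
    evalWeights (4 * n) (columnWeights w) = evalWeights (4 * (n + 1)) w := by
  have h0 : (4 * n % 4 != 0) = false := by simp
  have h1 : ((4 * n + 1) % 4 != 0) = true := by simp
  have h2 : ((4 * n + 2) % 4 != 0) = true := by simp
  have h3 : ((4 * n + 3) % 4 != 0) = true := by simp
  have e0 := evalWeights_stepWeights (4 * n)
  have e1 := evalWeights_stepWeights (4 * n + 1)
  have e2 := evalWeights_stepWeights (4 * n + 2)
  have e3 := evalWeights_stepWeights (4 * n + 3)
  rw [h0] at e0
  rw [h1] at e1
  rw [h2] at e2
  rw [h3] at e3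
  rw [columnWeights, e0, e1, e2, e3, mul_add]

/-! ### Column counts and their recurrence -/

/-- The number of orderings of `n` columns that start in the upper left corner. -/
noncomputable def columnCount (n : ℕ) : ℕ :=
  orderingCount (4 * n) [(0, 1)]

/-- The combination of consecutive values of `columnCount` with the given coefficients. -/
noncomputable def shiftCombination : List ℤ → ℕ → ℤ
  | [], _ => 0
  | c :: cs, n => c * columnCount n + shiftCombination cs (n + 1)

/-- Applying the column operator amounts to adding a column to the grid, so powers of the operator
become shifts of the count. -/
theorem evalWeights_horner (cs : List ℤ) (n : ℕ) :
    evalWeights (4 * n) (horner cs) = shiftCombination cs n := by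
  induction cs generalizing n with
  | nil => rfl
  | cons c cs ih =>
    rw [horner, evalWeights_addWeight, evalWeights_columnWeights, ih]
    rfl

theorem evalWeights_eq_zero {w : Weights} (h : (w.all fun e => e.2 == 0) = true) (m : ℕ) :
    evalWeights m w = 0 := by
  induction w with
  | nil => rfl
  | cons fc w ih =>
    rw [List.all_cons, Bool.and_eq_true, beq_iff_eq] at h
    rw [evalWeights, ih h.2, h.1, zero_mul, add_zero]

/-- `orderingCount 0`, in a form suited for evaluation. -/
def emptyCount (f : List Link) : ℤ :=
  if (0, 0) ∈ f ∧ ∀ e ∈ f, e = (0, 0) then 1 else 0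

/-- `evalWeights 0`, in a form suited for evaluation. -/
def evalEmpty : Weights → ℤ
  | [] => 0
  | (f, c) :: w => c * emptyCount f + evalEmpty w

theorem evalWeights_zero (w : Weights) : evalWeights 0 w = evalEmpty w := by
  induction w with
  | nil => rfl
  | cons fc w ih =>
    rw [evalWeights, evalEmpty, ih, orderingCount_zero, emptyCount]
    push_cast
    rfl

/-- The values of `w` on grids with `0, …, k - 1` columns. -/
def initialValues : ℕ → Weights → List ℤ
  | 0, _ => []
  | k + 1, w => evalEmpty w :: initialValues k (columnWeights w)

theorem initialValues_eq (k : ℕ) (w : Weights) :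
    initialValues k w = (List.range k).map fun n => evalWeights (4 * n) w := by
  induction k generalizing w with
  | zero => rfl
  | succ k ih =>
    rw [initialValues, ih, List.range_succ_eq_map, List.map_cons, List.map_map, mul_zero,
      evalWeights_zero]
    simp only [evalWeights_columnWeights]
    rfl

theorem map_columnCount_range :
    (List.range 17).map (fun n => (columnCount n : ℤ)) =
      [0, 1, 4, 17, 52, 160, 469, 1337, 3750, 10347, 28249, 76382, 204996, 546651, 1449952,
        3828232, 10067585] := by
  have h : initialValues 17 [([(0, 1)], 1)] = [0, 1, 4, 17, 52, 160, 469, 1337, 3750, 10347,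
      28249, 76382, 204996, 546651, 1449952, 3828232, 10067585] := by
    decide +kernel
  rw [← h, initialValues_eq]
  refine List.map_congr_left fun n _ => ?_
  rw [evalWeights, evalWeights, one_mul, add_zero, columnCount]

-- With lowest coefficient first, the list is x^2 (x^7 - 5x^5 + 4x^4 + 4x^3 - 5x^2 + 1) times the
-- characteristic polynomial of the order-eight recurrence. The kernel checks that every state gets
-- coefficient 0, a finite computation that settles all n.
set_option maxHeartbeats 4000000 in
theorem shiftCombination_eq_zero (n : ℕ) :
    shiftCombination [0, 0, -1, 3, 4, -24, 19, 47, -72, -40, 104, 8, -79, 13, 28, -8, -3, 1] n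
      = 0 := by
  rw [← evalWeights_horner]
  refine evalWeights_eq_zero ?_ _
  decide +kernel

theorem columnCount_values : ∀ n < 17, (columnCount n : ℤ) =
    [0, 1, 4, 17, 52, 160, 469, 1337, 3750, 10347, 28249, 76382, 204996, 546651, 1449952,
        3828232, 10067585].getD n 0 := by
  intro n hn
  rw [← map_columnCount_range, List.getD_eq_getElem _ _ (by simpa using hn)]
  simp

/-- The recurrence of order eight. -/
theorem columnCount_recurrence (n : ℕ) :
    (columnCount (n + 10) : ℤ) = 3 * columnCount (n + 9) + 3 * columnCount (n + 8)
      - 9 * columnCount (n + 7) - 6 * columnCount (n + 6) + 5 * columnCount (n + 5)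
      + columnCount (n + 4) - 3 * columnCount (n + 3) + columnCount (n + 2) := by
  have h : ∀ n, (columnCount (n + 17) : ℤ) = 3 * columnCount (n + 16) + 8 * columnCount (n + 15)
      - 28 * columnCount (n + 14) - 13 * columnCount (n + 13) + 79 * columnCount (n + 12)
      - 8 * columnCount (n + 11) - 104 * columnCount (n + 10) + 40 * columnCount (n + 9)
      + 72 * columnCount (n + 8) - 47 * columnCount (n + 7) - 19 * columnCount (n + 6)
      + 24 * columnCount (n + 5) - 4 * columnCount (n + 4) - 3 * columnCount (n + 3)
      + columnCount (n + 2) := by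
    intro n
    have := shiftCombination_eq_zero n
    simp only [shiftCombination, add_assoc] at this
    norm_num at this
    linarith
  have hv := columnCount_values
  induction n using Nat.strong_induction_on with
  | _ n ih =>
    by_cases hn : n < 7
    · have v2 := hv 2 (by norm_num)
      have v3 := hv 3 (by norm_num)
      have v4 := hv 4 (by norm_num)
      have v5 := hv 5 (by norm_num)
      have v6 := hv 6 (by norm_num)
      have v7 := hv 7 (by norm_num)
      have v8 := hv 8 (by norm_num)
      have v9 := hv 9 (by norm_num)
      have v10 := hv 10 (by norm_num)
      have v11 := hv 11 (by norm_num)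
      have v12 := hv 12 (by norm_num)
      have v13 := hv 13 (by norm_num)
      have v14 := hv 14 (by norm_num)
      have v15 := hv 15 (by norm_num)
      have v16 := hv 16 (by norm_num)
      norm_num at v2 v3 v4 v5 v6 v7 v8 v9 v10 v11 v12 v13 v14 v15 v16
      interval_cases n <;> norm_num <;> linarith
    -- The order-fifteen recurrence is a monic operator of degree 7 applied to the defect of the
    -- order-eight one, so a defect vanishing at seven consecutive indices vanishes at the next.
    · obtain ⟨k, rfl⟩ := Nat.exists_eq_add_of_le (not_lt.1 hn)
      have i0 := ih k (by omega)
      have i1 := ih (k + 1) (by omega)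
      have i2 := ih (k + 2) (by omega)
      have i3 := ih (k + 3) (by omega)
      have i4 := ih (k + 4) (by omega)
      have i5 := ih (k + 5) (by omega)
      have i6 := ih (k + 6) (by omega)
      have hk := h k
      simp only [add_assoc, add_comm 7 k] at *
      norm_num at *
      linarith

/-! ### Tours as orderings -/

open SimpleGraph

theorem forall_links_iff_isChain {m c : ℕ} {L : List ℕ} (hc : c ≠ 0) (hL : 0 ∉ L) :
    (∀ e ∈ links c L, GridLink m e.1 e.2) ↔ (c :: L).IsChain (GridLink m) := by
  induction L generalizing c with
  | nil => simp [links, GridLink, hc]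
  | cons x L ih =>
    rw [List.mem_cons, not_or] at hL
    rw [List.isChain_cons_cons, ← ih (Ne.symm hL.1) hL.2, links, List.forall_mem_cons]

/-- The prescribed link covers the entry into the corner and the exit to 0 is always free, so only
the grid steps remain. -/
theorem admissible_links_cons_iff {m : ℕ} {L : List ℕ} (hd : (0 :: 1 :: L).Nodup) :
    Admissible m [(0, 1)] (links 0 (1 :: L)) ↔ (1 :: L).IsChain (GridLink m) := by
  have h0 : 0 ∉ L := fun h => (List.nodup_cons.1 hd).1 (List.mem_cons_of_mem _ h)
  rw [← forall_links_iff_isChain one_ne_zero h0, links]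
  constructor
  · rintro ⟨-, h⟩ e he
    refine (h e (List.mem_cons_of_mem _ he)).resolve_left fun h' => ?_
    rw [List.mem_singleton] at h'
    have h1 : e.1 ∈ 1 :: L := by rw [← links_map_fst]; exact List.mem_map_of_mem he
    rw [h'] at h1
    exact (List.nodup_cons.1 hd).1 h1
  · intro h
    refine ⟨fun e he => ?_, fun e he => ?_⟩
    · rw [List.mem_singleton.1 he]; exact List.mem_cons_self
    · rcases List.mem_cons.1 he with rfl | he
      · exact Or.inl (List.mem_singleton.2 rfl)
      · exact Or.inr (h e he)

/-- The columnwise numbering of the vertices of the grid. -/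
def label {n : ℕ} (v : Fin (n + 1) × Fin 4) : ℕ :=
  4 * v.1 + (4 - v.2)

theorem label_injective {n : ℕ} : Function.Injective (label (n := n)) := by
  rintro ⟨x, y⟩ ⟨x', y'⟩ h
  simp only [label] at h
  refine Prod.ext (Fin.ext ?_) (Fin.ext ?_) <;> dsimp only <;> omega

theorem range_label (n : ℕ) : Set.range (label (n := n)) = {x | 1 ≤ x ∧ x ≤ 4 * (n + 1)} := by
  ext x
  constructor
  · rintro ⟨⟨x, y⟩, rfl⟩
    simp only [label, Set.mem_ofPred_eq]
    omega
  · rintro ⟨h1, h2⟩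
    refine ⟨(⟨(x - 1) / 4, by omega⟩, ⟨3 - (x - 1) % 4, by omega⟩), ?_⟩
    simp only [label]
    omega

theorem adj_iff_gridLink {n : ℕ} {v w : Fin (n + 1) × Fin 4} :
    (gridGraph 4 (n + 1)).Adj v w ↔ GridLink (4 * (n + 1)) (label v) (label w) := by
  obtain ⟨x, y⟩ := v
  obtain ⟨x', y'⟩ := w
  simp only [gridGraph, boxProd_adj, pathGraph_adj, GridLink, label, Fin.ext_iff]
  omega

theorem label_upperLeft (n : ℕ) : label (upperLeft 3 n) = 1 := rfl

theorem bijOn_greekKeyTours (n : ℕ) :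
    Set.BijOn (fun p : Σ v, (gridGraph 4 (n + 1)).Walk (upperLeft 3 n) v => p.2.support.map label)
      (greekKeyTours 3 n) (orderings (4 * (n + 1)) [(0, 1)]) := by
  refine ⟨?_, ?_, ?_⟩
  · rintro ⟨v, p⟩ ⟨⟨hp, -⟩, hall⟩
    have hd : (p.support.map label).Nodup := hp.support_nodup.map label_injective
    have hm : ∀ x, x ∈ p.support.map label ↔ 1 ≤ x ∧ x ≤ 4 * (n + 1) := by
      intro x
      have hr := Set.ext_iff.1 (range_label n) x
      rw [Set.mem_ofPred_eq] at hr
      rw [← hr, List.mem_map]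
      exact ⟨fun ⟨w, _, hw⟩ => ⟨w, hw⟩, fun ⟨w, hw⟩ => ⟨w, hall w, hw⟩⟩
    refine ⟨hd, hm, ?_⟩
    have hd0 : (0 :: p.support.map label).Nodup :=
      List.nodup_cons.2 ⟨fun h => by have := (hm 0).1 h; omega, hd⟩
    have hchain : (p.support.map label).IsChain (GridLink (4 * (n + 1))) :=
      (List.isChain_map label).2 (p.isChain_adj_support.imp fun _ _ h => adj_iff_gridLink.1 h)
    have hs : p.support.map label = 1 :: p.support.tail.map label := by
      conv_lhs => rw [← p.cons_tail_support]
      rfl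
    change Admissible _ _ (links 0 (p.support.map label))
    rw [hs] at hd0 hchain ⊢
    exact (admissible_links_cons_iff hd0).2 hchain
  · rintro ⟨v, p⟩ - ⟨w, q⟩ - h
    have hs : p.support = q.support := List.map_injective_iff.2 label_injective h
    obtain rfl : v = w := by
      rw [← p.getLast_support, ← q.getLast_support]
      simp only [hs]
    rw [Walk.ext_support hs]
  · rintro L ⟨hd, hm, hL⟩
    have hr : L ∈ Set.range (List.map (label (n := n))) := by
      rw [Set.range_list_map, range_label]
      exact fun x hx => (hm x).1 hx
    obtain ⟨S, rfl⟩ := hr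
    have hd0 : (0 :: S.map label).Nodup :=
      List.nodup_cons.2 ⟨fun h => by have := (hm 0).1 h; omega, hd⟩
    have h01 : (0, 1) ∈ links 0 (S.map label) := hL.1 _ (List.mem_singleton.2 rfl)
    cases S with
    | nil => simp [links] at h01
    | cons u S =>
      have hu : label u = 1 := (Prod.mk.inj
        (links_fst_injOn hd0 (g := (0, label u)) h01 List.mem_cons_self rfl)).2.symm
      obtain rfl : u = upperLeft 3 n := label_injective hu
      rw [List.map_cons, label_upperLeft] at hd0 hL
      have hchain : (upperLeft 3 n :: S).IsChain (gridGraph 4 (n + 1)).Adj :=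
        ((List.isChain_map label).1 ((admissible_links_cons_iff hd0).1 hL)).imp
          fun _ _ h => adj_iff_gridLink.2 h
      obtain ⟨v, p, hsup⟩ : ∃ v, ∃ p : (gridGraph 4 (n + 1)).Walk (upperLeft 3 n) v,
          p.support = upperLeft 3 n :: S :=
        ⟨_, Walk.ofSupport _ (List.cons_ne_nil _ S) hchain, Walk.support_ofSupport _ hchain⟩
      have hall : ∀ w, w ∈ upperLeft 3 n :: S := by
        intro w
        have hw : label w ∈ Set.range (label (n := n)) := ⟨w, rfl⟩
        rw [range_label] at hw
        obtain ⟨w', hw', h⟩ := List.mem_map.1 ((hm _).2 hw)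
        rwa [← label_injective h]
      have hpath : p.IsPath := by
        rw [Walk.isPath_def, hsup]
        exact List.Nodup.of_map label hd
      -- The trapping condition follows from visiting every vertex.
      exact ⟨⟨v, p⟩, ⟨⟨hpath, fun w _ => hsup ▸ hall w⟩, fun w => hsup ▸ hall w⟩,
        congrArg (List.map label) hsup⟩

theorem tourCount_four_succ (n : ℕ) :
    tourCount 4 (n + 1) = orderingCount (4 * (n + 1)) [(0, 1)] :=
  (bijOn_greekKeyTours n).ncard_eq

/-- At n = 0 the two differ: the empty tour counts as 1, while `columnCount 0` is 0. -/
theorem tourCount_four {n : ℕ} (hn : n ≠ 0) : tourCount 4 n = columnCount n := by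
  obtain ⟨k, rfl⟩ := Nat.exists_eq_succ_of_ne_zero hn
  exact tourCount_four_succ k

/-! ### Recurrence for tours and the generating function -/

theorem tourCount_four_recurrence {n : ℕ} (hn : 10 ≤ n) :
    (tourCount 4 n : ℤ) = 3 * tourCount 4 (n - 1) + 3 * tourCount 4 (n - 2)
      - 9 * tourCount 4 (n - 3) - 6 * tourCount 4 (n - 4) + 5 * tourCount 4 (n - 5)
      + tourCount 4 (n - 6) - 3 * tourCount 4 (n - 7) + tourCount 4 (n - 8) := by
  obtain ⟨k, rfl⟩ := Nat.exists_eq_add_of_le' hn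
  simpa [tourCount_four] using columnCount_recurrence k

theorem tourCount_four_zero : tourCount 4 0 = 1 := rfl

theorem tourCount_four_values {n : ℕ} (hn : n < 17) (h0 : n ≠ 0) : (tourCount 4 n : ℚ) =
    (([0, 1, 4, 17, 52, 160, 469, 1337, 3750, 10347, 28249, 76382, 204996, 546651, 1449952,
        3828232, 10067585].getD n 0 : ℤ) : ℚ) := by
  rw [← columnCount_values n hn, tourCount_four h0, Int.cast_natCast]

open PowerSeries in
theorem genFun_four_mul :
    genFun 4 * ((1 - X - 3 * X ^ 2 - X ^ 3 + X ^ 4) *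
      (1 - 2 * X - 2 * X ^ 2 + 2 * X ^ 3 - X ^ 4)) =
    1 - 2 * X - 2 * X ^ 2 + 11 * X ^ 3 + 4 * X ^ 4 - 10 * X ^ 5 + 4 * X ^ 6 + 2 * X ^ 7
      - 3 * X ^ 8 + X ^ 9 := by
  -- The denominator is expanded into monomials with scalar coefficients, so that coefficients can
  -- be read off.
  have h1 : genFun 4 * ((1 - X - 3 * X ^ 2 - X ^ 3 + X ^ 4) *
      (1 - 2 * X - 2 * X ^ 2 + 2 * X ^ 3 - X ^ 4)) =
      genFun 4 * X ^ 0 - (3 : ℚ) • (genFun 4 * X ^ 1) - (3 : ℚ) • (genFun 4 * X ^ 2)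
      + (9 : ℚ) • (genFun 4 * X ^ 3) + (6 : ℚ) • (genFun 4 * X ^ 4)
      - (5 : ℚ) • (genFun 4 * X ^ 5) - genFun 4 * X ^ 6 + (3 : ℚ) • (genFun 4 * X ^ 7)
      - genFun 4 * X ^ 8 := by
    simp only [smul_eq_C_mul, map_ofNat]
    ring
  have h2 : (1 - 2 * X - 2 * X ^ 2 + 11 * X ^ 3 + 4 * X ^ 4 - 10 * X ^ 5 + 4 * X ^ 6 + 2 * X ^ 7
      - 3 * X ^ 8 + X ^ 9 : PowerSeries ℚ) = X ^ 0 - (2 : ℚ) • X ^ 1 - (2 : ℚ) • X ^ 2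
      + (11 : ℚ) • X ^ 3 + (4 : ℚ) • X ^ 4 - (10 : ℚ) • X ^ 5 + (4 : ℚ) • X ^ 6 + (2 : ℚ) • X ^ 7
      - (3 : ℚ) • X ^ 8 + X ^ 9 := by
    simp only [smul_eq_C_mul, map_ofNat]
    ring
  rw [h1, h2]
  ext n
  simp only [map_add, map_sub, map_smul, coeff_mul_X_pow', coeff_X_pow, genFun, coeff_mk,
    smul_eq_mul]
  -- The numerator has degree 9: lower coefficients come from the computed values, the others from
  -- the recurrence.
  by_cases hn : n < 10
  · have hv := @tourCount_four_values
    interval_cases n <;> norm_num [hv, tourCount_four_zero]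
  · have h10 : 10 ≤ n := not_lt.1 hn
    have hr := congrArg (Int.cast : ℤ → ℚ) (tourCount_four_recurrence h10)
    push_cast at hr
    have hle : ∀ k < 10, k ≤ n := fun k hk => by omega
    have hne : ∀ k < 10, n ≠ k := fun k hk => by omega
    simp only [hle, hne, if_true, if_false, Nat.reduceLT, tsub_zero]
    linarith

end GreekKey

open PowerSeries in
theorem mainTheorem6 :
    GreekKey.genFun 4 =
      (1 - 2 * X - 2 * X ^ 2 + 11 * X ^ 3 + 4 * X ^ 4 - 10 * X ^ 5 + 4 * X ^ 6 + 2 * X ^ 7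
          - 3 * X ^ 8 + X ^ 9) *
        ((1 - X - 3 * X ^ 2 - X ^ 3 + X ^ 4) *
          (1 - 2 * X - 2 * X ^ 2 + 2 * X ^ 3 - X ^ 4) : PowerSeries ℚ)⁻¹ ∧
    ∀ n : ℕ, 10 ≤ n →
      (GreekKey.tourCount 4 n : ℤ) =
        3 * GreekKey.tourCount 4 (n - 1) + 3 * GreekKey.tourCount 4 (n - 2)
          - 9 * GreekKey.tourCount 4 (n - 3) - 6 * GreekKey.tourCount 4 (n - 4)
          + 5 * GreekKey.tourCount 4 (n - 5) + GreekKey.tourCount 4 (n - 6)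
          - 3 * GreekKey.tourCount 4 (n - 7) + GreekKey.tourCount 4 (n - 8) := by
  refine ⟨?_, fun n hn => GreekKey.tourCount_four_recurrence hn⟩
  rw [PowerSeries.eq_mul_inv_iff_mul_eq]
  · exact GreekKey.genFun_four_mul
  · simp
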